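/- Definitions. For an infinite cardinal $\nu$ let $\mathcal D_\nu=\bigcup_{\eta<\nu}\{0,1\}^\eta$ be the binary tree of height $\nu$ (its elements are called nodes, the elements of $\{0,1\}^\eta$ are the nodes on level $\eta$, and $s\le s'$ means that the sequence $s'$ extends $s$). A segment is a linearly ordered subset of $\mathcal D_\nu$ that contains every node lying strictly between two of its elements. A non-empty segment is an $\eta_1$-$\eta_2$ segment if $\eta_1$ is the least level of its nodes and $\eta_2$ is the least level of a node that is an upper bound of it. A finite family of segments is admissible if, for some ordinals $\eta_1<\eta_2$, its members are pairwise disjoint $\eta_1$-$\eta_2$ segments. The real Banach space $X_\nu$ is the completion of the space $c_{00}(\mathcal D_\nu)$ of finitely supported functions $x:\mathcal D_\nu\to\mathbb R$ under $$\|x\|=\sup\Big(\sum_{j=1}^r\Big|\sum_{s\in\mathcal I_j}x(s)\Big|^2\Big)^{1/2},$$ the supremum being over all finite admissible families $\{\mathcal I_j\}_{j=1}^r$. A branch is an element $B=(a_\xi)_{\xi<\nu}$ of $\{0,1\}^\nu$; it passes through the nodes $(a_\xi)_{\xi<\eta}$, $\eta<\nu$. The branch functional $B^*\in X_\nu^*$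 is the continuous extension of $x\mapsto\sum_{s}x(s)$, where $s$ runs over the nodes through which $B$ passes. For a set $A$ of branches put $A^*=\{B^*: B\in A\}$, and let $\Gamma_\nu^*$ be the set of all branch functionals on $X_\nu$. A sequence $(x_n)$ in a Banach space $X$ is weakly Cauchy if $(f(x_n))$ converges for every $f\in X^*$; a set contains no weakly Cauchy sequence if no sequence of pairwise distinct elements of it is weakly Cauchy. A set $T\subset X$ is equivalent to the usual $\ell_1(\kappa)$-basis if $|T|=\kappa$ and there are $C_1,C_2>0$ with $C_1\sum_{i=1}^n|a_i|\le\|\sum_{i=1}^n a_ix_i\|\le C_2\sum_{i=1}^n|a_i|$ for all $n$, all distinct $x_1,\dots,x_n\in T$ and all scalars $a_1,\dots,a_n$. Call a set $S\subset X$ a $\kappa$-counterexample if $S$ is bounded, $|S|=\kappa$, $S$ contains no weakly Cauchy sequence, and no subset of $S$ is equivalent to the usual $\ell_1(\kappa)$-basis. ($\aleph_0$ counts as a strong limit cardinal.) Theorem. Let $\kappa$ be an uncountable cardinal such that $\kappa$ is not a strong limit or $\mathrm{cf}(\kappa)$ is not a strong limit. Then some Banach space contains a $\kappa$-counterexample.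 More precisely: (1) Suppose that $\kappa$ is not a strong limit. Then there is an infinite cardinal $\lambda<\kappa$ with $\kappa\le 2^\lambda$. For every such $\lambda$, the set $\Gamma_\lambda^*\subset X_\lambda^*$ is bounded, has cardinality $2^\lambda\ge\kappa$, contains no weakly Cauchy sequence, and has no subset equivalent to the usual $\ell_1(\kappa)$-basis. In particular, there are sets $A\subset\{0,1\}^\lambda$ with $|A|=\kappa$, and for each of them $A^*$ is a $\kappa$-counterexample in $X_\lambda^*$. (2) Suppose that $\kappa$ is a strong limit but $\mathrm{cf}(\kappa)$ is not. Then there is a cardinal $\lambda<\mathrm{cf}(\kappa)$ with $\mathrm{cf}(\kappa)\le 2^\lambda$. For every such $\lambda$, there are cardinals $\kappa_i<\kappa$ $(i<\mathrm{cf}(\kappa))$ with $\sum_{i<\mathrm{cf}(\kappa)}\kappa_i=\kappa$, pairwise distinct nodes $t_i$ $(i<\mathrm{cf}(\kappa))$ on level $\lambda$ of $\mathcal D_\kappa$, and sets $A_i\subset\{0,1\}^\kappa$ with $|A_i|=\kappa_i$ such that every branch in $A_i$ passes through $t_i$. For every such choice, with $A=\bigcup_{i<\mathrm{cf}(\kappa)}A_i$,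 the set $A^*$ is a $\kappa$-counterexample in $X_\kappa^*$. -/

import Mathlib

open Cardinal

universe u v

noncomputable section

namespace NonsepTree

/-! ### The standard tree `{0,1}^{<κ}` and its branches

The ordinals below `κ` are the elements of the well-ordered type `κ.ord.ToType`. -/

/-- A node of the tree `{0,1}^{<κ}`: an ordinal `lev < κ` (its level) together with a sequence
of zeros and ones indexed by the ordinals below `lev`. -/
structure Node (κ : Cardinal.{u}) : Type u where
  lev : κ.ord.ToType
  val : Set.Iio lev → Bool

/-- A branch of the tree: an element of `{0,1}^κ`. -/
abbrev Branch (κ : Cardinal.{u}) : Type u := κ.ord.ToType → Bool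

variable {κ : Cardinal.{u}}

/-- The initial segment ordering: `s ≤ t` iff the sequence `t` extends the sequence `s`. -/
instance : LE (Node κ) :=
  ⟨fun s t => ∃ h : s.lev ≤ t.lev, ∀ ξ : Set.Iio s.lev, s.val ξ = t.val ⟨ξ, ξ.2.trans_le h⟩⟩

theorem Node.le_def {s t : Node κ} : s ≤ t ↔
    ∃ h : s.lev ≤ t.lev, ∀ ξ : Set.Iio s.lev, s.val ξ = t.val ⟨ξ, ξ.2.trans_le h⟩ := Iff.rfl

instance : PartialOrder (Node κ) where
  le_refl s := ⟨le_rfl, fun _ => rfl⟩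
  le_trans s t r := by
    rintro ⟨h1, e1⟩ ⟨h2, e2⟩
    exact ⟨h1.trans h2, fun ξ => (e1 ξ).trans (e2 _)⟩
  le_antisymm s t := by
    rintro ⟨h1, e1⟩ ⟨h2, _⟩
    obtain ⟨a, f⟩ := s
    obtain ⟨b, g⟩ := t
    obtain rfl : a = b := le_antisymm h1 h2
    congr 1
    funext ξ
    exact e1 ξ

/-- The node of the branch `B = (a_ξ)_{ξ<κ}` on level `η`, that is `(a_ξ)_{ξ<η}`. -/
def Branch.node (B : Branch κ) (η : κ.ord.ToType) : Node κ := ⟨η, fun ξ => B ξ⟩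

/-- The branch `B`, identified with the set of nodes that it passes through. -/
def Branch.nodes (B : Branch κ) : Set (Node κ) := Set.range B.node

/-! ### Segments and admissible families -/

/-- A segment: a linearly ordered set of nodes that contains every node lying between two of its
elements. -/
def IsSegment (I : Set (Node κ)) : Prop :=
  IsChain (· ≤ ·) I ∧ ∀ s ∈ I, ∀ s' ∈ I, ∀ t, s < t → t < s' → t ∈ I

/-- `I` is an `η₁`-`η₂` segment: it is a segment, `η₁` is the least level of a node of `I`, and
`η₂` is the least level of a node that is an upper bound of `I`. -/
def IsSegmentFromTo (η₁ η₂ : κ.ord.ToType) (I : Set (Node κ)) : Prop :=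
  IsSegment I ∧ IsLeast {η | ∃ s ∈ I, s.lev = η} η₁ ∧
    IsLeast {η | ∃ s' : Node κ, s'.lev = η ∧ ∀ s ∈ I, s ≤ s'} η₂

/-- A finite family of segments is admissible if its members are pairwise disjoint
`η₁`-`η₂` segments for common ordinals `η₁ < η₂`. -/
def IsAdmissible {r : ℕ} (I : Fin r → Set (Node κ)) : Prop :=
  (∃ η₁ η₂ : κ.ord.ToType, η₁ < η₂ ∧ ∀ j, IsSegmentFromTo η₁ η₂ (I j)) ∧
    ∀ i j, i ≠ j → Disjoint (I i) (I j)

/-! ### The normed space `c₀₀(D)` -/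

variable (κ) in
/-- The space of finitely supported functions on the nodes. -/
def C00 : Type u := Node κ →₀ ℝ

instance : AddCommGroup (C00 κ) := inferInstanceAs (AddCommGroup (Node κ →₀ ℝ))

instance : FunLike (C00 κ) (Node κ) ℝ := inferInstanceAs (FunLike (Node κ →₀ ℝ) (Node κ) ℝ)

instance : Module ℝ (C00 κ) := inferInstanceAs (Module ℝ (Node κ →₀ ℝ))

/-- The functional `I^*(x) = ∑_{s ∈ I} x(s)` on `c₀₀(D)`. -/
def segSum (I : Set (Node κ)) : C00 κ →ₗ[ℝ] ℝ :=
  Finsupp.linearCombination ℝ (I.indicator fun _ => (1 : ℝ))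

/-- The values whose supremum is the norm of `x`. -/
def normSet (x : C00 κ) : Set ℝ :=
  {v | ∃ (r : ℕ) (I : Fin r → Set (Node κ)), IsAdmissible I ∧
    v = Real.sqrt (∑ j, |segSum (I j) x| ^ 2)}

theorem segSum_apply (I : Set (Node κ)) (x : C00 κ) :
    segSum I x = ∑ s ∈ Finsupp.support x, x s * I.indicator (fun _ => (1 : ℝ)) s := by
  rfl

theorem bddAbove_normSet (x : C00 κ) : BddAbove (normSet x) := by
  classical
  refine ⟨∑ s ∈ Finsupp.support x, |x s|, ?_⟩
  rintro _ ⟨r, I, ⟨-, hd⟩, rfl⟩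
  have h0 : ∀ s : Node κ, ∑ j, (I j).indicator (fun _ => (1 : ℝ)) s ≤ 1 := by
    intro s
    by_cases h : ∃ j, s ∈ I j
    · obtain ⟨j, hj⟩ := h
      rw [Finset.sum_eq_single j]
      · simp [hj]
      · intro i _ hij
        exact Set.indicator_of_notMem (fun hi => Set.disjoint_left.1 (hd i j hij) hi hj) _
      · simp
    · push Not at h
      rw [Finset.sum_eq_zero]
      · norm_num
      · intro j _
        exact Set.indicator_of_notMem (h j) _
  have h1 : ∑ j, |segSum (I j) x| ≤ ∑ s ∈ Finsupp.support x, |x s| := by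
    calc ∑ j, |segSum (I j) x|
        ≤ ∑ j, ∑ s ∈ Finsupp.support x,
            |x s| * (I j).indicator (fun _ => (1 : ℝ)) s := by
          refine Finset.sum_le_sum fun j _ => ?_
          rw [segSum_apply]
          refine (Finset.abs_sum_le_sum_abs _ _).trans (le_of_eq ?_)
          refine Finset.sum_congr rfl fun s _ => ?_
          rw [abs_mul]
          congr 1
          exact abs_of_nonneg (Set.indicator_nonneg (fun _ _ => zero_le_one) _)
      _ = ∑ s ∈ Finsupp.support x,
            |x s| * ∑ j, (I j).indicator (fun _ => (1 : ℝ)) s := by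
          rw [Finset.sum_comm]
          simp [Finset.mul_sum]
      _ ≤ _ := by
          refine Finset.sum_le_sum fun s _ => ?_
          exact mul_le_of_le_one_right (abs_nonneg _) (h0 s)
  have hn : 0 ≤ ∑ j, |segSum (I j) x| := Finset.sum_nonneg fun _ _ => abs_nonneg _
  rw [Real.sqrt_le_left (hn.trans h1)]
  refine le_trans ?_ (pow_le_pow_left₀ hn h1 2)
  exact Finset.sum_sq_le_sq_sum_of_nonneg fun _ _ => abs_nonneg _

theorem sqrt_sum_add_le {r : ℕ} (a b : Fin r → ℝ) :
    Real.sqrt (∑ j, |a j + b j| ^ 2) ≤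
      Real.sqrt (∑ j, |a j| ^ 2) + Real.sqrt (∑ j, |b j| ^ 2) := by
  have := norm_add_le (WithLp.toLp 2 a : EuclideanSpace ℝ (Fin r)) (WithLp.toLp 2 b)
  simpa [EuclideanSpace.norm_eq] using this

/-- The norm `‖x‖ = sup (∑_j |I_j^*(x)|²)^{1/2}`, the supremum being taken over all finite
admissible families of segments, as a seminorm (see `eq_zero_of_norm_eq_zero`). -/
def treeSeminorm : Seminorm ℝ (C00 κ) :=
  Seminorm.ofSMulLE (fun x => sSup (normSet x))
    (by
      refine le_antisymm (Real.sSup_le ?_ le_rfl) (Real.sSup_nonneg ?_)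
      · rintro _ ⟨r, I, -, rfl⟩
        simp
      · rintro _ ⟨r, I, -, rfl⟩
        positivity)
    (by
      intro x y
      have hnn : ∀ z : C00 κ, 0 ≤ sSup (normSet z) := fun z =>
        Real.sSup_nonneg (by rintro _ ⟨r, I, -, rfl⟩; positivity)
      refine Real.sSup_le ?_ (add_nonneg (hnn x) (hnn y))
      rintro _ ⟨r, I, hI, rfl⟩
      simp only [map_add]
      refine (sqrt_sum_add_le _ _).trans (add_le_add ?_ ?_)
      · exact le_csSup (bddAbove_normSet x) ⟨r, I, hI, rfl⟩
      · exact le_csSup (bddAbove_normSet y) ⟨r, I, hI, rfl⟩)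
    (by
      intro c x
      have hnn : 0 ≤ sSup (normSet x) :=
        Real.sSup_nonneg (by rintro _ ⟨r, I, -, rfl⟩; positivity)
      refine Real.sSup_le ?_ (mul_nonneg (norm_nonneg c) hnn)
      rintro _ ⟨r, I, hI, rfl⟩
      have : Real.sqrt (∑ j, |segSum (I j) (c • x)| ^ 2)
          = ‖c‖ * Real.sqrt (∑ j, |segSum (I j) x| ^ 2) := by
        simp only [map_smul, smul_eq_mul, abs_mul, mul_pow, ← Finset.mul_sum]
        rw [Real.sqrt_mul (by positivity), Real.sqrt_sq (abs_nonneg c), Real.norm_eq_abs]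
      rw [this]
      exact mul_le_mul_of_nonneg_left (le_csSup (bddAbove_normSet x) ⟨r, I, hI, rfl⟩)
        (norm_nonneg c))

instance : SeminormedAddCommGroup (C00 κ) :=
  treeSeminorm.toAddGroupSeminorm.toSeminormedAddCommGroup

theorem norm_def (x : C00 κ) : ‖x‖ = sSup (normSet x) := rfl

instance : NormedSpace ℝ (C00 κ) where
  norm_smul_le c x := (map_smul_eq_mul treeSeminorm c x).le

theorem le_norm_of_isAdmissible (x : C00 κ) {r : ℕ} {I : Fin r → Set (Node κ)}
    (hI : IsAdmissible I) : Real.sqrt (∑ j, |segSum (I j) x| ^ 2) ≤ ‖x‖ :=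
  le_csSup (bddAbove_normSet x) ⟨r, I, hI, rfl⟩

/-! ### The Banach space `X_κ` -/

variable (κ) in
/-- The Banach space `X_κ`: the completion of `c₀₀(D)`. -/
abbrev X : Type u := UniformSpace.Completion (C00 κ)

/-! ### Branch functionals -/

theorem Branch.node_le_node (B : Branch κ) {η ζ : κ.ord.ToType} (h : η ≤ ζ) :
    B.node η ≤ B.node ζ := ⟨h, fun _ => rfl⟩

/-- The part of a branch between the levels `η₁ ≤ η₂` (both included) is an `η₁`-`η₂` segment. -/
theorem Branch.isSegmentFromTo (B : Branch κ) {η₁ η₂ : κ.ord.ToType} (h : η₁ ≤ η₂) :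
    IsSegmentFromTo η₁ η₂ (B.node '' Set.Icc η₁ η₂) := by
  refine ⟨⟨?_, ?_⟩, ⟨?_, ?_⟩, ?_, ?_⟩
  · rintro _ ⟨a, -, rfl⟩ _ ⟨b, -, rfl⟩ -
    rcases le_total a b with hab | hab
    · exact Or.inl (B.node_le_node hab)
    · exact Or.inr (B.node_le_node hab)
  · rintro _ ⟨a, ha, rfl⟩ _ ⟨b, hb, rfl⟩ ⟨c, f⟩ h1 h2
    obtain ⟨h1l, -⟩ := h1.le
    obtain ⟨h2l, h2e⟩ := h2.le
    refine ⟨c, ⟨ha.1.trans h1l, le_trans h2l hb.2⟩, ?_⟩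
    unfold Branch.node
    congr 1
    funext ξ
    exact (h2e ξ).symm
  · exact ⟨B.node η₁, ⟨η₁, ⟨le_rfl, h⟩, rfl⟩, rfl⟩
  · rintro _ ⟨_, ⟨a, ha, rfl⟩, rfl⟩
    exact ha.1
  · refine ⟨B.node η₂, rfl, ?_⟩
    rintro _ ⟨a, ha, rfl⟩
    exact B.node_le_node ha.2
  · rintro _ ⟨s', rfl, hs'⟩
    exact (hs' (B.node η₂) ⟨η₂, ⟨h, le_rfl⟩, rfl⟩).1

theorem abs_segSum_le_norm (x : C00 κ) {η₁ η₂ : κ.ord.ToType} (h : η₁ < η₂)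
    {I : Set (Node κ)} (hI : IsSegmentFromTo η₁ η₂ I) : |segSum I x| ≤ ‖x‖ := by
  have hadm : IsAdmissible (fun _ : Fin 1 => I) :=
    ⟨⟨η₁, η₂, h, fun _ => hI⟩, fun i j hij => (hij (Subsingleton.elim i j)).elim⟩
  have := le_norm_of_isAdmissible x hadm
  simpa [Real.sqrt_sq_eq_abs] using this

theorem exists_support_lt (hκ : ℵ₀ ≤ κ) (x : C00 κ) (η₀ : κ.ord.ToType) :
    ∃ η, η₀ < η ∧ ∀ s ∈ Finsupp.support x, Node.lev s ≤ η := by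
  classical
  have := noMaxOrder hκ
  have : Nonempty κ.ord.ToType := ⟨η₀⟩
  obtain ⟨η, hη⟩ := (insert η₀ ((Finsupp.support x).image Node.lev)).exists_le
  obtain ⟨ζ, hζ⟩ := exists_gt η
  refine ⟨ζ, lt_of_le_of_lt (hη _ (Finset.mem_insert_self _ _)) hζ, fun s hs => ?_⟩
  exact (hη _ (Finset.mem_insert_of_mem (Finset.mem_image_of_mem _ hs))).trans hζ.le

theorem Branch.abs_segSum_nodes_le (hκ : ℵ₀ ≤ κ) (B : Branch κ) (x : C00 κ) :
    |segSum B.nodes x| ≤ ‖x‖ := by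
  have hne : κ.ord ≠ 0 := by
    simpa using (aleph0_pos.trans_le hκ).ne'
  have : Nonempty κ.ord.ToType := Ordinal.nonempty_toType_iff.2 hne
  let := WellFoundedLT.toOrderBot κ.ord.ToType
  obtain ⟨η, h0, hη⟩ := exists_support_lt hκ x ⊥
  have : segSum B.nodes x = segSum (B.node '' Set.Icc ⊥ η) x := by
    rw [segSum_apply, segSum_apply]
    refine Finset.sum_congr rfl fun s hs => ?_
    congr 1
    have : s ∈ B.nodes ↔ s ∈ B.node '' Set.Icc ⊥ η := by
      constructor
      · rintro ⟨a, rfl⟩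
        exact ⟨a, ⟨bot_le, hη _ hs⟩, rfl⟩
      · rintro ⟨a, -, rfl⟩
        exact ⟨a, rfl⟩
    by_cases hm : s ∈ B.nodes
    · rw [Set.indicator_of_mem hm, Set.indicator_of_mem (this.1 hm)]
    · rw [Set.indicator_of_notMem hm, Set.indicator_of_notMem (fun h => hm (this.2 h))]
  rw [this]
  exact abs_segSum_le_norm x h0 (B.isSegmentFromTo h0.le)

/-- For infinite `κ` the seminorm on `c₀₀(D)` is a norm. -/
theorem eq_zero_of_norm_eq_zero (hκ : ℵ₀ ≤ κ) (x : C00 κ) (hx : ‖x‖ = 0) : x = 0 := by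
  classical
  by_contra hne
  obtain ⟨s, hs, hmax⟩ := (Finsupp.support x).exists_max_image Node.lev
    (Finsupp.support_nonempty_iff.2 hne)
  have := noMaxOrder hκ
  obtain ⟨ζ, hζ⟩ := exists_gt s.lev
  let B : Branch κ := fun ξ => if h : ξ < s.lev then s.val ⟨ξ, h⟩ else false
  have hBs : B.node s.lev = s := by
    obtain ⟨a, f⟩ := s
    unfold Branch.node
    congr 1
    funext ξ
    have : (ξ : κ.ord.ToType) < a := ξ.2
    simp [B, this]
  have h1 := abs_segSum_le_norm x hζ (B.isSegmentFromTo hζ.le)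
  have h2 : segSum (B.node '' Set.Icc s.lev ζ) x = x s := by
    rw [segSum_apply, Finset.sum_eq_single s]
    · have hmem : s ∈ B.node '' Set.Icc s.lev ζ := ⟨s.lev, ⟨le_rfl, hζ.le⟩, hBs⟩
      rw [Set.indicator_of_mem hmem, mul_one]
    · intro t ht hts
      rw [Set.indicator_of_notMem, mul_zero]
      rintro ⟨a, ha, rfl⟩
      have : a = s.lev := le_antisymm (hmax _ ht) ha.1
      rw [this] at hts
      exact hts hBs
    · intro h
      exact absurd hs h
  rw [h2, hx] at h1
  exact (Finsupp.mem_support_iff.1 hs) (abs_eq_zero.1 (le_antisymm h1 (abs_nonneg _)))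

/-- The functional `B^*` of a branch `B`: the continuous extension to `X_κ` of the functional
`x ↦ ∑_{s ∈ B} x(s)` on `c₀₀(D)`. -/
def Branch.functional (hκ : ℵ₀ ≤ κ) (B : Branch κ) : StrongDual ℝ (X κ) :=
  ((segSum B.nodes).mkContinuous 1
    (fun x => by simpa using B.abs_segSum_nodes_le hκ x)).extend
      (UniformSpace.Completion.toComplL : C00 κ →L[ℝ] X κ)

theorem Branch.functional_coe (hκ : ℵ₀ ≤ κ) (B : Branch κ) (x : C00 κ) :
    B.functional hκ (x : X κ) = segSum B.nodes x :=
  ContinuousLinearMap.extend_eq _ UniformSpace.Completion.denseRange_coe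
    (UniformSpace.Completion.isUniformInducing_coe (C00 κ)) x

/-- The family `A^* = {B^* : B ∈ A}` of the functionals of the branches in `A`; in particular
`Γ^*` is `branchFunctionals hκ Set.univ`. -/
def branchFunctionals (hκ : ℵ₀ ≤ κ) (A : Set (Branch κ)) : Set (StrongDual ℝ (X κ)) :=
  (fun B => B.functional hκ) '' A

/-! ### Weakly Cauchy sequences and `ℓ₁`-bases -/

section Banach

variable {E : Type v} [NormedAddCommGroup E] [NormedSpace ℝ E]

/-- A sequence is weakly Cauchy if `(f(x_n))` converges for every `f` in the dual. -/
def IsWeaklyCauchy (x : ℕ → E) : Prop :=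
  ∀ f : StrongDual ℝ E, ∃ l : ℝ, Filter.Tendsto (fun n => f (x n)) Filter.atTop (nhds l)

/-- The set `S` contains a weakly Cauchy sequence (of pairwise distinct elements). -/
def ContainsWeaklyCauchySeq (S : Set E) : Prop :=
  ∃ x : ℕ → E, Function.Injective x ∧ (∀ n, x n ∈ S) ∧ IsWeaklyCauchy x

/-- The set `S` has cardinality `κ` and is equivalent to the usual `ℓ₁(κ)`-basis. -/
def IsEquivalentToEllOneBasis (κ : Cardinal.{v}) (S : Set E) : Prop :=
  #S = κ ∧ ∃ C₁ C₂ : ℝ, 0 < C₁ ∧ 0 < C₂ ∧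
    ∀ (F : Finset E) (a : E → ℝ), (F : Set E) ⊆ S →
      C₁ * ∑ x ∈ F, |a x| ≤ ‖∑ x ∈ F, a x • x‖ ∧ ‖∑ x ∈ F, a x • x‖ ≤ C₂ * ∑ x ∈ F, |a x|

/-- `S` is a negative answer to Haydon's problem for `κ`: a bounded set of cardinality `κ` that
contains no weakly Cauchy sequence and has no subset equivalent to the usual `ℓ₁(κ)`-basis. -/
structure IsHaydonCounterexample (κ : Cardinal.{v}) (S : Set E) : Prop where
  isBounded : Bornology.IsBounded S
  card_eq : #S = κ
  no_weaklyCauchy : ¬ ContainsWeaklyCauchySeq S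
  no_ellOneBasis : ∀ T ⊆ S, ¬ IsEquivalentToEllOneBasis κ T

end Banach

/-! ### The choice of branches in the strong limit case -/

/-- `A` is a family of branches chosen as follows: `κ` is the sum of cardinals `c i < κ`,
`i < cf(κ)`; the `t i` are pairwise distinct nodes on level `μ`; `A` is the union of sets `A' i`
of `c i` many branches passing through `t i`. -/
def IsSpreadFamily (κ μ : Cardinal.{u}) (A : Set (Branch κ)) : Prop :=
  ∃ (c : κ.ord.cof.ord.ToType → Cardinal.{u}) (t : κ.ord.cof.ord.ToType → Node κ)
    (A' : κ.ord.cof.ord.ToType → Set (Branch κ)),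
    (∀ i, c i < κ) ∧ Cardinal.sum c = κ ∧
    Function.Injective t ∧ (∀ i, ((t i).lev.toOrd : Ordinal.{u}) = μ.ord) ∧
    (∀ i, #(A' i) = c i) ∧ (∀ i, ∀ B ∈ A' i, t i ∈ B.nodes) ∧
    A = ⋃ i, A' i

end NonsepTree

end

namespace NonsepTree

variable {κ : Cardinal.{u}}

/-! Two properties of the tree norm carry the proof.

No injective sequence of branch functionals is weakly Cauchy. An ultrafilter limit `t` of the
branches yields infinitely many of them that leave `t` at strictly increasing levels
(`exists_comb`). The alternating sums of unit vectors along `t` at these levels stay in the unit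
ball (`norm_alternatingSum_le`), because segments of an admissible family start on a common level
and are disjoint, so at most one of them meets `t`. A weak* cluster point of these sums in the
bidual takes the values 1, 0, 1, 0, ... on the chosen branch functionals.

A set of branches containing, for every `N`, `N` pairs that share a node on one level, with
different nodes for different pairs (`HasManyPairs`), does not give an ℓ₁-basis. In the sum of the
`N` differences the parts below that level cancel, and Cauchy-Schwarz over an admissible family
bounds the norm by `2√N`, against the lower bound `2 C₁ N`.

It remains to find such pairs in every large set of branches. If the set has more elements than the
height of the tree, pigeonhole on isolation levels does it (`hasManyPairs_of_lt_mk`). In a spread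
family, `κ` branches must hit infinitely many of the pieces at least twice, and different pieces are
separated on level `μ` (`IsSpreadFamily.hasManyPairs`). -/

theorem Branch.node_eq_node_iff {B B' : Branch κ} {η : κ.ord.ToType} :
    B.node η = B'.node η ↔ ∀ ξ < η, B ξ = B' ξ := by
  constructor
  · intro h ξ hξ
    simp only [Branch.node, Node.mk.injEq, heq_eq_eq, true_and] at h
    exact congrFun h ⟨ξ, hξ⟩
  · intro h
    simp only [Branch.node, Node.mk.injEq, heq_eq_eq, true_and]
    funext ξ
    exact h ξ ξ.2

theorem Branch.node_mem_nodes_iff {B B' : Branch κ} {η : κ.ord.ToType} :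
    B.node η ∈ B'.nodes ↔ ∀ ξ < η, B ξ = B' ξ := by
  rw [← Branch.node_eq_node_iff]
  constructor
  · rintro ⟨ζ, h⟩
    have : ζ = η := congrArg Node.lev h
    subst this
    exact h.symm
  · intro h
    exact ⟨η, h.symm⟩

/-- The first level at which two different branches take different values. -/
theorem Branch.exists_first_ne {B B' : Branch κ} (h : B ≠ B') :
    ∃ d, B d ≠ B' d ∧ ∀ ξ < d, B ξ = B' ξ := by
  have hne : {ξ | B ξ ≠ B' ξ}.Nonempty := Function.ne_iff.1 h
  refine ⟨wellFounded_lt.min _ hne, wellFounded_lt.min_mem _ hne, fun ξ hξ => ?_⟩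
  by_contra hc
  exact wellFounded_lt.not_lt_min _ hc hξ

/-! ### Unit vectors, segment sums, and norms of branch functionals -/

/-- The unit vector of a node. -/
noncomputable def single (s : Node κ) : C00 κ := Finsupp.single s (1 : ℝ)

theorem segSum_single (I : Set (Node κ)) (s : Node κ) :
    segSum I (single s) = I.indicator (fun _ => (1 : ℝ)) s := by
  unfold segSum single
  exact (Finsupp.linearCombination_single ℝ (1 : ℝ) s).trans (one_smul _ _)

theorem segSum_congr {I J : Set (Node κ)} {x : C00 κ}
    (h : ∀ s ∈ Finsupp.support x, s ∈ I ↔ s ∈ J) : segSum I x = segSum J x := by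
  classical
  rw [segSum_apply, segSum_apply]
  refine Finset.sum_congr rfl fun s hs => ?_
  simp only [Set.indicator_apply, h s hs]

theorem segSum_union {I J : Set (Node κ)} (h : Disjoint I J) (x : C00 κ) :
    segSum (I ∪ J) x = segSum I x + segSum J x := by
  simp only [segSum_apply, ← Finset.sum_add_distrib, ← mul_add]
  refine Finset.sum_congr rfl fun s _ => ?_
  rw [Set.indicator_union_of_disjoint h]

theorem Branch.functional_single (hκ : ℵ₀ ≤ κ) (B : Branch κ) (s : Node κ) :
    B.functional hκ (single s : X κ) = B.nodes.indicator (fun _ => (1 : ℝ)) s := by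
  rw [Branch.functional_coe, segSum_single]

theorem Branch.functional_injective (hκ : ℵ₀ ≤ κ) :
    Function.Injective (fun B : Branch κ => B.functional hκ) := by
  intro B B' h
  by_contra hne
  obtain ⟨d, hd, -⟩ := Branch.exists_first_ne hne
  have := noMaxOrder hκ
  obtain ⟨η, hη⟩ := exists_gt d
  have h1 := congrArg (fun f => f (single (B.node η) : X κ)) h
  simp only [Branch.functional_single] at h1
  rw [Set.indicator_of_mem (show B.node η ∈ B.nodes from ⟨η, rfl⟩), Set.indicator_of_notMem] at h1
  · exact one_ne_zero h1
  · rw [Branch.node_mem_nodes_iff]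
    exact fun h => hd (h d hη)

theorem norm_dual_le_of_coe (f : StrongDual ℝ (X κ)) {C : ℝ} (hC : 0 ≤ C)
    (h : ∀ x : C00 κ, |f (x : X κ)| ≤ C * ‖x‖) : ‖f‖ ≤ C := by
  refine f.opNorm_le_bound hC fun y => ?_
  induction y using UniformSpace.Completion.induction_on with
  | hp => exact isClosed_le (by fun_prop) (by fun_prop)
  | ih x => simpa [UniformSpace.Completion.norm_coe] using h x

theorem Branch.norm_functional_le (hκ : ℵ₀ ≤ κ) (B : Branch κ) : ‖B.functional hκ‖ ≤ 1 :=
  norm_dual_le_of_coe _ zero_le_one fun x => by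
    rw [Branch.functional_coe, one_mul]
    exact B.abs_segSum_nodes_le hκ x

theorem isBounded_branchFunctionals (hκ : ℵ₀ ≤ κ) (A : Set (Branch κ)) :
    Bornology.IsBounded (branchFunctionals hκ A) := by
  refine (Metric.isBounded_closedBall (x := 0) (r := 1)).subset ?_
  rintro _ ⟨B, -, rfl⟩
  simpa using B.norm_functional_le hκ

theorem mk_branchFunctionals (hκ : ℵ₀ ≤ κ) (A : Set (Branch κ)) :
    #(branchFunctionals hκ A) = #A :=
  mk_image_eq (Branch.functional_injective hκ)

/-! ### Sums of tails of branches -/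

/-- The nodes of a branch on the levels from `η` on. -/
def Branch.tail (B : Branch κ) (η : κ.ord.ToType) : Set (Node κ) := B.node '' Set.Ici η

/-- The nodes of a branch below the level `η`. -/
def Branch.head (B : Branch κ) (η : κ.ord.ToType) : Set (Node κ) := B.node '' Set.Iio η

theorem Branch.segSum_nodes_eq (B : Branch κ) (η : κ.ord.ToType) (x : C00 κ) :
    segSum B.nodes x = segSum (B.head η) x + segSum (B.tail η) x := by
  rw [← segSum_union]
  · rw [Branch.head, Branch.tail, ← Set.image_union, Set.Iio_union_Ici, Set.image_univ]
    rfl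
  · rw [Set.disjoint_left]
    rintro _ ⟨a, ha, rfl⟩ ⟨b, hb, h⟩
    have : b = a := congrArg Node.lev h
    subst this
    exact not_lt.2 (Set.mem_Ici.1 hb) ha

theorem Branch.head_congr {B B' : Branch κ} {η : κ.ord.ToType} (h : B.node η = B'.node η) :
    B.head η = B'.head η := by
  refine Set.image_congr fun ξ hξ => ?_
  rw [Branch.node_eq_node_iff] at h ⊢
  exact fun ζ hζ => h ζ (hζ.trans hξ)

theorem Branch.node_congr_le {B B' : Branch κ} {η ζ : κ.ord.ToType} (hηζ : η ≤ ζ)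
    (h : B.node ζ = B'.node ζ) : B.node η = B'.node η := by
  rw [Branch.node_eq_node_iff] at h ⊢
  exact fun ξ hξ => h ξ (hξ.trans_le hηζ)

/-- Branches through different nodes on level `η` stay disjoint from there on. Cut off above the
support of `x`, their tails form an admissible family, and Cauchy-Schwarz gives the factor `√N`. -/
theorem abs_sum_segSum_tail_le (hκ : ℵ₀ ≤ κ) {N : ℕ} (B : Fin N → Branch κ) (η : κ.ord.ToType)
    (hB : Function.Injective fun i => (B i).node η) (x : C00 κ) :
    |∑ i, segSum ((B i).tail η) x| ≤ Real.sqrt N * ‖x‖ := by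
  obtain ⟨ζ, hηζ, hζ⟩ := exists_support_lt hκ x η
  have hadm : IsAdmissible fun i => (B i).node '' Set.Icc η ζ := by
    refine ⟨⟨η, ζ, hηζ, fun i => (B i).isSegmentFromTo hηζ.le⟩, fun i j hij => ?_⟩
    rw [Set.disjoint_left]
    rintro _ ⟨a, ha, rfl⟩ ⟨b, hb, h⟩
    have : b = a := congrArg Node.lev h
    subst this
    exact hij (hB (Branch.node_congr_le ha.1 h.symm))
  have htail : ∀ i, segSum ((B i).tail η) x = segSum ((B i).node '' Set.Icc η ζ) x := by
    intro i
    refine segSum_congr fun s hs => ⟨?_, ?_⟩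
    · rintro ⟨a, ha, rfl⟩
      exact ⟨a, ⟨ha, hζ _ hs⟩, rfl⟩
    · rintro ⟨a, ha, rfl⟩
      exact ⟨a, ha.1, rfl⟩
  simp only [htail]
  refine le_trans ?_ (mul_le_mul_of_nonneg_left (le_norm_of_isAdmissible x hadm)
    (Real.sqrt_nonneg _))
  rw [← Real.sqrt_mul (Nat.cast_nonneg _)]
  refine Real.abs_le_sqrt ?_
  simpa using sq_sum_le_card_mul_sum_sq (s := (Finset.univ : Finset (Fin N)))
    (f := fun i => segSum ((B i).node '' Set.Icc η ζ) x)

/-- The heads of `B i` and `B' i` below `η` coincide and cancel, leaving two sums of tails with norm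
at most `√N` each. -/
theorem norm_sum_functional_sub_le (hκ : ℵ₀ ≤ κ) {N : ℕ} (B B' : Fin N → Branch κ)
    (η : κ.ord.ToType) (hBB' : ∀ i, (B i).node η = (B' i).node η)
    (hB : Function.Injective fun i => (B i).node η) :
    ‖∑ i, ((B i).functional hκ - (B' i).functional hκ)‖ ≤ 2 * Real.sqrt N := by
  refine norm_dual_le_of_coe _ (by positivity) fun x => ?_
  have hB' : Function.Injective fun i => (B' i).node η := by
    simpa only [hBB'] using hB
  have h1 := abs_sum_segSum_tail_le hκ B η hB x
  have h2 := abs_sum_segSum_tail_le hκ B' η hB' x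
  have : (∑ i, ((B i).functional hκ - (B' i).functional hκ)) (x : X κ) =
      ∑ i, segSum ((B i).tail η) x - ∑ i, segSum ((B' i).tail η) x := by
    rw [sum_apply, ← Finset.sum_sub_distrib]
    refine Finset.sum_congr rfl fun i _ => ?_
    rw [sub_apply, Branch.functional_coe, Branch.functional_coe,
      Branch.segSum_nodes_eq _ η, Branch.segSum_nodes_eq (B' i) η, Branch.head_congr (hBB' i)]
    ring
  rw [this]
  refine (abs_sub _ _).trans ?_
  linarith

/-- The set `T` has arbitrarily many pairs of branches which split only above a common level at
which different pairs pass through different nodes. -/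
def HasManyPairs (T : Set (Branch κ)) : Prop :=
  ∀ N : ℕ, ∃ (η : κ.ord.ToType) (B B' : Fin N → Branch κ), (∀ i, B i ∈ T) ∧ (∀ i, B' i ∈ T) ∧
    (∀ i, B i ≠ B' i) ∧ (∀ i, (B i).node η = (B' i).node η) ∧
    Function.Injective fun i => (B i).node η

theorem HasManyPairs.not_isEquivalentToEllOneBasis (hκ : ℵ₀ ≤ κ) {T : Set (Branch κ)}
    (hT : HasManyPairs T) (ν : Cardinal.{u}) :
    ¬ IsEquivalentToEllOneBasis ν (branchFunctionals hκ T) := by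
  classical
  rintro ⟨-, C₁, C₂, hC₁, -, h⟩
  -- This makes `C₁ √N > 1`, so the lower estimate `2 C₁ N` exceeds the upper estimate `2 √N`.
  obtain ⟨N, hN⟩ := exists_nat_gt ((1 / C₁) ^ 2)
  obtain ⟨η, B, B', hBT, hBT', hne, hnode, hinj⟩ := hT N
  let φ : Branch κ → StrongDual ℝ (X κ) := fun B => B.functional hκ
  have hφ : Function.Injective φ := Branch.functional_injective hκ
  have hBinj : Function.Injective B := fun i j hij => hinj (by simp [hij])
  have hBinj' : Function.Injective B' := fun i j hij => hinj (by simp [hnode, hij])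
  let F : Finset (StrongDual ℝ (X κ)) := Finset.univ.image fun i => φ (B i)
  let F' : Finset (StrongDual ℝ (X κ)) := Finset.univ.image fun i => φ (B' i)
  have hdisj : Disjoint F F' := by
    rw [Finset.disjoint_left]
    intro y hy hy'
    obtain ⟨i, -, rfl⟩ := Finset.mem_image.1 hy
    obtain ⟨j, -, hj⟩ := Finset.mem_image.1 hy'
    have hij : B' j = B i := hφ hj
    obtain rfl : i = j := hinj (by simp only [hnode j, hij])
    exact hne i hij.symm
  -- Only the values on `F ∪ F'` matter; since `F` and `F'` are disjoint, the coefficient is `-1` on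
  -- all of `F'`.
  let a : StrongDual ℝ (X κ) → ℝ := fun y => if y ∈ F then 1 else -1
  have ha : ∀ i, a (φ (B i)) = 1 := fun i => by simp [a, F]
  have ha' : ∀ i, a (φ (B' i)) = -1 := fun i =>
    if_neg (Finset.disjoint_right.1 hdisj (Finset.mem_image_of_mem _ (Finset.mem_univ i)))
  have hsub : ((F ∪ F' : Finset _) : Set (StrongDual ℝ (X κ))) ⊆ branchFunctionals hκ T := by
    intro y hy
    rcases Finset.mem_union.1 hy with hy | hy
    · obtain ⟨i, -, rfl⟩ := Finset.mem_image.1 hy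
      exact ⟨B i, hBT i, rfl⟩
    · obtain ⟨i, -, rfl⟩ := Finset.mem_image.1 hy
      exact ⟨B' i, hBT' i, rfl⟩
  have h1 := (h (F ∪ F') a hsub).1
  have e1 : ∑ y ∈ F ∪ F', |a y| = 2 * N := by
    rw [Finset.sum_union hdisj, Finset.sum_image (fun i _ j _ hij => hBinj (hφ hij)),
      Finset.sum_image (fun i _ j _ hij => hBinj' (hφ hij))]
    simp [ha, ha', two_mul]
  have e2 : ∑ y ∈ F ∪ F', a y • y = ∑ i, (φ (B i) - φ (B' i)) := by
    rw [Finset.sum_union hdisj, Finset.sum_image (fun i _ j _ hij => hBinj (hφ hij)),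
      Finset.sum_image (fun i _ j _ hij => hBinj' (hφ hij)), ← Finset.sum_add_distrib]
    refine Finset.sum_congr rfl fun i _ => ?_
    rw [ha, ha', one_smul, sub_eq_add_neg]
    exact congrArg _ (neg_one_smul ℝ (φ (B' i)))
  rw [e1, e2] at h1
  have h2 := h1.trans (norm_sum_functional_sub_le hκ B B' η hnode hinj)
  have hlt : 1 / C₁ < Real.sqrt N := Real.lt_sqrt_of_sq_lt hN
  have hpos : 0 < Real.sqrt N := lt_trans (by positivity) hlt
  rw [div_lt_iff₀ hC₁] at hlt
  have hs : Real.sqrt N * Real.sqrt N = N := Real.mul_self_sqrt (Nat.cast_nonneg _)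
  nlinarith

/-! ### Weakly Cauchy sequences of branch functionals -/

section WeaklyCauchy

open Filter Topology

/-- Infinitely many branches contain a sequence that splits off a branch at increasing levels. -/
theorem exists_comb (B : ℕ → Branch κ) (hB : Function.Injective B) :
    ∃ (t : Branch κ) (n : ℕ → ℕ) (d : ℕ → κ.ord.ToType), Function.Injective n ∧ StrictMono d ∧
      ∀ k, B (n k) (d k) ≠ t (d k) ∧ ∀ ξ < d k, B (n k) ξ = t ξ := by
  classical
  let U := hyperfilter ℕ
  -- The pointwise limit of the branches along the nonprincipal ultrafilter `U`; by injectivity at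
  -- most one `B n` equals it.
  let t : Branch κ := fun ξ => decide (∀ᶠ n in U, B n ξ = true)
  have ht : ∀ ξ, ∀ᶠ n in U, B n ξ = t ξ := by
    intro ξ
    by_cases h : ∀ᶠ n in U, B n ξ = true
    · simp only [t, h, decide_true]
    · simp only [t, h, decide_false]
      rw [← Ultrafilter.eventually_not] at h
      simpa using h
  have hne : ∀ᶠ n in U, B n ≠ t := by
    refine (Nat.hyperfilter_le_atTop).trans (Nat.cofinite_eq_atTop.ge) ?_
    refine Set.Subsingleton.finite ?_
    intro a ha b hb
    simp only [Set.mem_compl_iff, Set.mem_ofPred_eq, not_not] at ha hb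
    exact hB (ha.trans hb.symm)
  have hd : ∀ n, ∃ d, B n ≠ t → B n d ≠ t d ∧ ∀ ξ < d, B n ξ = t ξ := by
    intro n
    by_cases h : B n = t
    · by_cases hκ : Nonempty κ.ord.ToType
      · exact ⟨hκ.some, fun h' => absurd h h'⟩
      · exact absurd (hB (funext fun ξ => absurd ⟨ξ⟩ hκ : B 0 = B 1)) zero_ne_one
    · obtain ⟨d, hd⟩ := Branch.exists_first_ne h
      exact ⟨d, fun _ => hd⟩
  choose D hD using hd
  -- If only finitely many splitting levels occurred, `U`-almost all `B n` would agree with `t` at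
  -- all of them, including their own.
  have hinf : (D '' {n | B n ≠ t}).Infinite := by
    intro hfin
    have h1 : ∀ᶠ n in U, ∀ ξ ∈ D '' {n | B n ≠ t}, B n ξ = t ξ :=
      (eventually_all_finite hfin).2 fun ξ _ => ht ξ
    obtain ⟨n, hn, hn'⟩ := (h1.and hne).exists
    exact (hD n hn').1 (hn _ ⟨n, hn', rfl⟩)
  -- Distinct levels have a strictly monotone subsequence; a decreasing one is impossible in a
  -- well-order.
  obtain ⟨g, hg⟩ := exists_increasing_or_nonincreasing_subseq (· < ·)
    (fun k => (hinf.natEmbedding _ k : κ.ord.ToType))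
  have hmono : StrictMono fun k => (hinf.natEmbedding _ (g k) : κ.ord.ToType) := by
    rcases hg with hg | hg
    · exact fun m n hmn => hg m n hmn
    · exfalso
      refine not_strictAnti_of_wellFoundedLT
        (fun k => (hinf.natEmbedding _ (g k) : κ.ord.ToType)) ?_
      intro m n hmn
      refine lt_of_le_of_ne (not_lt.1 (hg m n hmn)) fun h => ?_
      exact hmn.ne' (g.injective ((hinf.natEmbedding _).injective (Subtype.ext h)))
  have hmem : ∀ k, ∃ n, B n ≠ t ∧ D n = hinf.natEmbedding _ (g k) := fun k =>
    (hinf.natEmbedding _ (g k)).2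
  choose n hn hDn using hmem
  refine ⟨t, n, _, fun i j hij => hmono.injective ?_, hmono, fun k => ?_⟩
  · simp only [← hDn, hij]
  · rw [← hDn]
    exact hD _ (hn k)

theorem abs_sum_Ico_neg_one_pow_le (a b : ℕ) : |∑ k ∈ Finset.Ico a b, (-1 : ℝ) ^ k| ≤ 1 := by
  rcases le_total a b with h | h
  · rw [Finset.sum_Ico_eq_sub _ h, neg_one_geom_sum, neg_one_geom_sum]
    split_ifs <;> norm_num
  · simp [Finset.Ico_eq_empty_of_le h]

theorem abs_sum_ordConnected_neg_one_pow_le (S : Finset ℕ)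
    (hS : Set.OrdConnected (S : Set ℕ)) : |∑ k ∈ S, (-1 : ℝ) ^ k| ≤ 1 := by
  rcases S.eq_empty_or_nonempty with rfl | hne
  · simp
  · have : S = Finset.Ico (S.min' hne) (S.max' hne + 1) := by
      ext k
      rw [Finset.mem_Ico, Nat.lt_succ_iff]
      exact ⟨fun hk => ⟨S.min'_le k hk, S.le_max' k hk⟩, fun hk =>
        hS.out (S.min'_mem hne) (S.max'_mem hne) hk⟩
    rw [this]
    exact abs_sum_Ico_neg_one_pow_le _ _

/-- A segment that meets a branch starts on this branch. -/
theorem IsSegmentFromTo.node_mem {η₁ η₂ : κ.ord.ToType} {I : Set (Node κ)}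
    (hI : IsSegmentFromTo η₁ η₂ I) {t : Branch κ} {a : κ.ord.ToType} (ha : t.node a ∈ I) :
    t.node η₁ ∈ I := by
  obtain ⟨⟨hchain, -⟩, ⟨⟨s, hs, hlev⟩, hmin⟩, -⟩ := hI
  have hle : η₁ ≤ a := hmin ⟨_, ha, rfl⟩
  have hst : s ≤ t.node a := by
    rcases hchain.total hs ha with h | h
    · exact h
    · have h' : a ≤ s.lev := Node.le_def.1 h |>.1
      have : a = s.lev := le_antisymm h' (hlev ▸ hle)
      refine ⟨this.ge, fun ξ => ?_⟩
      exact ((Node.le_def.1 h).2 ⟨ξ, lt_of_lt_of_le ξ.2 this.ge⟩).symm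
  have : s = t.node η₁ := by
    obtain ⟨l, f⟩ := s
    obtain rfl : l = η₁ := hlev
    unfold Branch.node
    congr 1
    funext ξ
    exact (Node.le_def.1 hst).2 ξ
  exact this ▸ hs

/-- The alternating sum of the unit vectors of nodes of a branch. -/
noncomputable def alternatingSum (t : Branch κ) (d : ℕ → κ.ord.ToType) (N : ℕ) : C00 κ :=
  ∑ k ∈ Finset.range N, (-1 : ℝ) ^ k • single (t.node (d k))

open Classical in
theorem segSum_alternatingSum (I : Set (Node κ)) (t : Branch κ) (d : ℕ → κ.ord.ToType) (N : ℕ) :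
    segSum I (alternatingSum t d N) =
      ∑ k ∈ (Finset.range N).filter (fun k => t.node (d k) ∈ I), (-1 : ℝ) ^ k := by
  simp [alternatingSum, segSum_single, Set.indicator_apply, Finset.sum_filter]

/-- A segment meeting `t` contains the node of `t` on its initial level `η₁`, so in an admissible
family only one segment contributes. By convexity it picks out consecutive indices, whose
alternating signs sum to at most 1 in absolute value. -/
theorem norm_alternatingSum_le (t : Branch κ) {d : ℕ → κ.ord.ToType} (hd : StrictMono d) (N : ℕ) :
    ‖alternatingSum t d N‖ ≤ 1 := by
  classical
  rw [norm_def]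
  refine Real.sSup_le ?_ zero_le_one
  rintro _ ⟨r, I, ⟨⟨η₁, η₂, -, hI⟩, hdisj⟩, rfl⟩
  have hone : ∀ j, |segSum (I j) (alternatingSum t d N)| ≤ 1 := by
    intro j
    rw [segSum_alternatingSum]
    refine abs_sum_ordConnected_neg_one_pow_le _ ⟨?_⟩
    intro a ha b hb c hc
    simp only [Finset.coe_filter, Finset.mem_range, Set.mem_ofPred_eq] at ha hb ⊢
    refine ⟨hc.2.trans_lt hb.1, ?_⟩
    rcases hc.1.eq_or_lt with rfl | hac
    · exact ha.2
    rcases hc.2.eq_or_lt with rfl | hcb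
    · exact hb.2
    have hlt : ∀ {i j : ℕ}, i < j → t.node (d i) < t.node (d j) := fun {i j} hij =>
      lt_of_le_of_ne (t.node_le_node (hd hij).le) fun h => (hd hij).ne (congrArg Node.lev h)
    exact (hI j).1.2 _ ha.2 _ hb.2 _ (hlt hac) (hlt hcb)
  have hzero : ∀ j, t.node η₁ ∉ I j → segSum (I j) (alternatingSum t d N) = 0 := by
    intro j hj
    rw [segSum_alternatingSum, Finset.filter_false_of_mem, Finset.sum_empty]
    exact fun k _ hk => hj ((hI j).node_mem hk)
  refine Real.sqrt_le_one.2 ?_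
  by_cases h : ∃ j, t.node η₁ ∈ I j
  · obtain ⟨j, hj⟩ := h
    rw [Finset.sum_eq_single j]
    · exact pow_le_one₀ (abs_nonneg _) (hone j)
    · intro i _ hij
      rw [hzero i (Set.disjoint_right.1 (hdisj i j hij) hj)]
      simp
    · simp
  · push Not at h
    rw [Finset.sum_eq_zero]
    · exact zero_le_one
    · intro j _
      rw [hzero j (h j)]
      simp

theorem functional_alternatingSum (hκ : ℵ₀ ≤ κ) {t B : Branch κ} {d : ℕ → κ.ord.ToType}
    (hd : StrictMono d) {k N : ℕ} (hkN : k < N) (hne : B (d k) ≠ t (d k))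
    (heq : ∀ ξ < d k, B ξ = t ξ) :
    B.functional hκ (alternatingSum t d N : X κ) = if Even k then 1 else 0 := by
  classical
  rw [Branch.functional_coe, segSum_alternatingSum]
  -- The index `k` itself is included: the node on level `d k` records only values below `d k`,
  -- where `B` and `t` still agree.
  have : (Finset.range N).filter (fun i => t.node (d i) ∈ B.nodes) = Finset.range (k + 1) := by
    ext i
    rw [Finset.mem_filter, Finset.mem_range, Finset.mem_range, Nat.lt_succ_iff,
      Branch.node_mem_nodes_iff]
    constructor
    · rintro ⟨-, h⟩
      by_contra hik
      exact hne (h _ (hd (not_le.1 hik))).symm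
    · exact fun hik => ⟨hik.trans_lt hkN, fun ξ hξ => (heq ξ (hξ.trans_le (hd.monotone hik))).symm⟩
  rw [this, neg_one_geom_sum]
  by_cases h : Even k <;> simp [h, Nat.even_add_one]

/-- A bounded sequence has a weak* cluster point in the bidual. -/
theorem exists_bidual_tendsto {E : Type v} [NormedAddCommGroup E] [NormedSpace ℝ E] (x : ℕ → E)
    (hx : ∀ n, ‖x n‖ ≤ 1) :
    ∃ f : StrongDual ℝ (StrongDual ℝ E), ∀ φ : StrongDual ℝ E,
      Tendsto (fun n => φ (x n)) (hyperfilter ℕ) (𝓝 (f φ)) := by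
  let y : ℕ → WeakDual ℝ (StrongDual ℝ E) := fun n =>
    StrongDual.toWeakDual (NormedSpace.inclusionInDoubleDual ℝ E (x n))
  have hc := WeakDual.isCompact_closedBall (𝕜 := ℝ) (E := StrongDual ℝ E) 0 1
  obtain ⟨f, -, hf⟩ := isCompact_iff_ultrafilter_le_nhds.1 hc ((hyperfilter ℕ).map y) (by
    rw [Ultrafilter.coe_map, le_principal_iff, mem_map]
    refine Eventually.of_forall fun n => ?_
    simp only [Set.mem_preimage, Metric.mem_closedBall, dist_zero_right]
    refine le_trans ?_ (hx n)
    exact NormedSpace.double_dual_bound ℝ E (x n))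
  refine ⟨WeakDual.toStrongDual f, fun φ => ?_⟩
  exact ((WeakDual.eval_continuous φ).tendsto f).comp hf

/-- The witness against convergence is a bidual cluster point of the alternating sums along the
spine of a comb. Its value on the `k`-th tooth is already attained by every sum with more than `k`
terms. -/
theorem not_containsWeaklyCauchySeq (hκ : ℵ₀ ≤ κ) (A : Set (Branch κ)) :
    ¬ ContainsWeaklyCauchySeq (branchFunctionals hκ A) := by
  rintro ⟨y, hy, hyA, hcauchy⟩
  choose B hBA hBy using hyA
  have hB : Function.Injective B := fun i j hij => hy (by rw [← hBy, ← hBy, hij])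
  obtain ⟨t, n, d, hn, hd, h⟩ := exists_comb B hB
  obtain ⟨f, hf⟩ := exists_bidual_tendsto (fun N => (alternatingSum t d N : X κ)) fun N => by
    rw [UniformSpace.Completion.norm_coe]
    exact norm_alternatingSum_le t hd N
  have hval : ∀ k, f (y (n k)) = if Even k then 1 else 0 := by
    intro k
    refine tendsto_nhds_unique (hf _) (tendsto_const_nhds.congr' ?_)
    refine Nat.hyperfilter_le_atTop ?_
    filter_upwards [eventually_gt_atTop k] with N hN
    rw [← hBy]
    exact (functional_alternatingSum hκ hd hN (h k).1 (h k).2).symm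
  obtain ⟨l, hl⟩ := hcauchy f
  -- The indices `n k` need not increase; injectivity alone makes them tend to infinity.
  have hl' := hl.comp hn.nat_tendsto_atTop
  have he : Tendsto (fun k : ℕ => 2 * k) atTop atTop :=
    tendsto_id.const_mul_atTop' two_pos
  have ho : Tendsto (fun k : ℕ => 2 * k + 1) atTop atTop := tendsto_add_atTop_nat 1 |>.comp he
  have h1 : l = 1 := tendsto_nhds_unique (hl'.comp he) (by simp [Function.comp_def, hval])
  have h0 : l = 0 := tendsto_nhds_unique (hl'.comp ho)
    (by simp [Function.comp_def, hval])
  exact one_ne_zero (h1.symm.trans h0)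

end WeaklyCauchy

/-! ### Sets of more than `κ` branches -/

theorem mk_branch (κ : Cardinal.{u}) : #(Branch κ) = 2 ^ κ := by
  simp

open Classical in
/-- The first level at which `B` is separated from the other branches in `T`, or `⊤`. -/
noncomputable def isolationLevel (T : Set (Branch κ)) (B : Branch κ) : WithTop κ.ord.ToType :=
  if h : {η | ∀ B' ∈ T, B'.node η = B.node η → B' = B}.Nonempty then
    (wellFounded_lt.min _ h : κ.ord.ToType) else ⊤

theorem exists_ne_of_lt_isolationLevel {T : Set (Branch κ)} {B : Branch κ} {ξ : κ.ord.ToType}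
    (h : ξ < isolationLevel T B) : ∃ B' ∈ T, B'.node ξ = B.node ξ ∧ B' ≠ B := by
  by_contra! hc
  have hne : {η | ∀ B' ∈ T, B'.node η = B.node η → B' = B}.Nonempty := ⟨ξ, hc⟩
  rw [isolationLevel, dif_pos hne, WithTop.coe_lt_coe] at h
  exact wellFounded_lt.not_lt_min {η | ∀ B' ∈ T, B'.node η = B.node η → B' = B} hc h

theorem eq_of_isolationLevel_le {T : Set (Branch κ)} {B B' : Branch κ} {ξ : κ.ord.ToType}
    (h : isolationLevel T B ≤ ξ) (hB' : B' ∈ T) (heq : B'.node ξ = B.node ξ) : B' = B := by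
  by_cases hne : {η | ∀ B' ∈ T, B'.node η = B.node η → B' = B}.Nonempty
  · rw [isolationLevel, dif_pos hne, WithTop.coe_le_coe] at h
    exact wellFounded_lt.min_mem _ hne B' hB' (Branch.node_congr_le h heq)
  · rw [isolationLevel, dif_neg hne] at h
    exact absurd h (by simp)

/-- There are only `κ` possible isolation levels, so infinitely many branches share one, `a`. Among
finitely many of these, the highest splitting level `ξ` lies below `a`. On level `ξ` they pass
through many nodes, and none of them is isolated there, so each has a partner in `T`. -/
theorem hasManyPairs_of_lt_mk (hκ : ℵ₀ ≤ κ) {T : Set (Branch κ)} (hT : κ < #T) :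
    HasManyPairs T := by
  classical
  intro N
  have hcard : #(WithTop κ.ord.ToType) < #T := by
    refine lt_of_eq_of_lt ?_ hT
    refine (mk_option (α := κ.ord.ToType)).trans ?_
    rw [mk_ord_toType]
    exact add_one_eq hκ
  have hTinf : Infinite T := infinite_iff.2 (hκ.trans hT.le)
  obtain ⟨a, ha⟩ := exists_infinite_fiber (fun B : T => isolationLevel T B) hcard
  -- At most two chosen branches will share a node on level `ξ`, so `2 * N` would supply `N` nodes;
  -- the extra 2 guarantees a pair to split even for `N = 0`.
  obtain ⟨F', hF'⟩ := Infinite.exists_subset_card_eq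
    ((fun B : T => isolationLevel T B) ⁻¹' {a}) (2 * N + 2)
  let F : Finset (Branch κ) := F'.image fun B => B.1.1
  have hF : F.card = 2 * N + 2 := by
    rw [Finset.card_image_of_injective, hF']
    exact Subtype.val_injective.comp Subtype.val_injective
  have hFT : ∀ B ∈ F, B ∈ T ∧ isolationLevel T B = a := by
    intro B hB
    obtain ⟨B', -, rfl⟩ := Finset.mem_image.1 hB
    exact ⟨B'.1.2, B'.2⟩
  have hlevels : Nonempty κ.ord.ToType := Ordinal.nonempty_toType_iff.2
    (by simpa using (aleph0_pos.trans_le hκ).ne')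
  have hsplit : ∀ p : Branch κ × Branch κ, p ∈ F.offDiag →
      ∃ d, p.1 d ≠ p.2 d ∧ ∀ ξ < d, p.1 ξ = p.2 ξ := fun p hp =>
    Branch.exists_first_ne (Finset.mem_offDiag.1 hp).2.2
  choose! Δ hΔ using hsplit
  have hoff : F.offDiag.Nonempty := by
    obtain ⟨x, hx, y, hy, hxy⟩ := Finset.one_lt_card.1 (show 1 < F.card by omega)
    exact ⟨(x, y), Finset.mem_offDiag.2 ⟨hx, hy, hxy⟩⟩
  obtain ⟨p, hp, hmax⟩ := F.offDiag.exists_max_image Δ hoff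
  obtain ⟨hp1, hp2, hpne⟩ := Finset.mem_offDiag.1 hp
  let ξ := Δ p
  -- The two branches of `p` share their node on level `ξ`, so the first is not yet isolated there.
  have hξ : (ξ : WithTop κ.ord.ToType) < a := by
    by_contra hle
    rw [not_lt, ← (hFT _ hp1).2] at hle
    refine hpne (eq_of_isolationLevel_le hle (hFT _ hp2).1 ?_).symm
    rw [Branch.node_eq_node_iff]
    exact fun ζ hζ => ((hΔ p hp).2 ζ hζ).symm
  -- By maximality of `ξ`, any two members of `F` differ at or below `ξ`, so the node on level `ξ`
  -- and the next bit determine the branch.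
  have hcardim : F.card ≤ 2 * (F.image fun B => B.node ξ).card := by
    have := Finset.card_le_card_of_injOn (s := F)
      (t := (F.image fun B => B.node ξ) ×ˢ (Finset.univ : Finset Bool))
      (fun B => (B.node ξ, B ξ))
      (fun B hB => by simpa using ⟨B, hB, rfl⟩)
      (by
        intro B hB B' hB' h
        by_contra hne
        obtain ⟨h1, h2⟩ := Prod.mk.inj h
        have hq : (B, B') ∈ F.offDiag := Finset.mem_offDiag.2 ⟨hB, hB', hne⟩
        rcases (hmax _ hq).lt_or_eq with hlt | heq
        · exact (hΔ _ hq).1 (Branch.node_eq_node_iff.1 h1 _ hlt)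
        · refine (hΔ _ hq).1 ?_
          rw [heq]
          exact h2)
    simpa [mul_comm] using this
  obtain ⟨G, hG, hGcard⟩ := Finset.exists_subset_card_eq
    (show N ≤ (F.image fun B => B.node ξ).card by omega)
  let e := (Finset.equivFinOfCardEq hGcard).symm
  have hB : ∀ i, ∃ B ∈ F, B.node ξ = e i := fun i => Finset.mem_image.1 (hG (e i).2)
  choose B hBF hBe using hB
  have hB' : ∀ i, ∃ B' ∈ T, B'.node ξ = (B i).node ξ ∧ B' ≠ B i := fun i =>
    exists_ne_of_lt_isolationLevel ((hFT _ (hBF i)).2 ▸ hξ)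
  choose B' hBT' hnode hne using hB'
  refine ⟨ξ, B, B', fun i => (hFT _ (hBF i)).1, hBT', fun i => (hne i).symm,
    fun i => (hnode i).symm, fun i j hij => e.injective (Subtype.ext ?_)⟩
  simpa only [hBe] using hij

/-! ### Spread families -/

theorem Branch.node_lev_of_mem_nodes {B : Branch κ} {s : Node κ} (h : s ∈ B.nodes) :
    B.node s.lev = s := by
  obtain ⟨η, rfl⟩ := h
  rfl

theorem IsSpreadFamily.mk_eq {μ : Cardinal.{u}} {A : Set (Branch κ)}
    (hA : IsSpreadFamily κ μ A) : #A = κ := by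
  obtain ⟨c, t, A', -, hsum, hinj, hlev, hcard, hpass, rfl⟩ := hA
  rw [mk_iUnion_eq_sum_mk]
  · simpa only [hcard] using hsum
  · intro i j hij
    refine Set.disjoint_left.2 fun B hi hj => hij (hinj ?_)
    have h1 := Branch.node_lev_of_mem_nodes (hpass i B hi)
    have h2 := Branch.node_lev_of_mem_nodes (hpass j B hj)
    have : (t i).lev = (t j).lev :=
      Ordinal.ToType.mk.symm.injective (Subtype.ext ((hlev i).trans (hlev j).symm))
    rw [← h1, ← h2, this]

/-- Two branches of `T` in the same piece share its node on level `μ`, and different pieces have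
different nodes there. It therefore suffices that infinitely many pieces contain two elements of
`T`. -/
theorem IsSpreadFamily.hasManyPairs (hκ : ℵ₀ < κ) (hcof : κ.ord.cof < κ) {μ : Cardinal.{u}}
    {A : Set (Branch κ)} (hA : IsSpreadFamily κ μ A) {T : Set (Branch κ)} (hTA : T ⊆ A)
    (hT : #T = κ) : HasManyPairs T := by
  classical
  obtain ⟨c, t, A', hc, -, hinj, hlev, hcard, hpass, rfl⟩ := hA
  have hS : {i | (T ∩ A' i).Nontrivial}.Infinite := by
    intro hfin
    -- A maximum of finitely many cardinals below `κ` stays below `κ`. The other pieces meet `T` in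
    -- at most one branch, so `T` would have at most `cf(κ) * max m ℵ₀ < κ` elements.
    let m : Cardinal.{u} := hfin.toFinset.sup c
    have hm : m < κ := (Finset.sup_lt_iff (aleph0_pos.trans hκ)).2 fun i _ => hc i
    have hbound : ∀ i, #(T ∩ A' i : Set (Branch κ)) ≤ max m ℵ₀ := by
      intro i
      by_cases hi : (T ∩ A' i).Nontrivial
      · refine (mk_le_mk_of_subset Set.inter_subset_right).trans ?_
        rw [hcard]
        exact le_max_of_le_left (Finset.le_sup (f := c) (hfin.mem_toFinset.2 hi))
      · rw [Set.not_nontrivial_iff] at hi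
        exact (mk_le_one_iff_set_subsingleton.2 hi).trans
          (one_lt_aleph0.le.trans (le_max_right _ _))
    have hle : #T ≤ κ.ord.cof * max m ℵ₀ := by
      have : T = ⋃ i, T ∩ A' i := by
        rw [← Set.inter_iUnion, Set.inter_eq_left.2 hTA]
      calc #T = #(⋃ i, T ∩ A' i : Set (Branch κ)) := by rw [← this]
        _ ≤ #κ.ord.cof.ord.ToType * ⨆ i, #(T ∩ A' i : Set (Branch κ)) := mk_iUnion_le _
        _ ≤ κ.ord.cof * max m ℵ₀ := by
          rw [mk_ord_toType]
          exact mul_le_mul_right (ciSup_le' hbound) _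
    exact (hT ▸ hle).not_gt (mul_lt_of_lt hκ.le hcof (max_lt hm hκ))
  intro N
  let i : ℕ → κ.ord.cof.ord.ToType := fun k => hS.natEmbedding _ k
  have hi : Function.Injective i := Subtype.val_injective.comp (hS.natEmbedding _).injective
  have hiS : ∀ k, (T ∩ A' (i k)).Nontrivial := fun k => (hS.natEmbedding _ k).2
  choose B hB B' hB' hne using hiS
  have hl : ∀ k, (t (i k)).lev = (t (i 0)).lev := fun k =>
    Ordinal.ToType.mk.symm.injective (Subtype.ext ((hlev _).trans (hlev _).symm))
  have hnode : ∀ k, ∀ C ∈ A' (i k), C.node (t (i 0)).lev = t (i k) := by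
    intro k C hC
    rw [← hl k]
    exact Branch.node_lev_of_mem_nodes (hpass _ C hC)
  refine ⟨(t (i 0)).lev, fun k : Fin N => B k, fun k : Fin N => B' k, fun k => (hB k).1,
    fun k => (hB' k).1, fun k => hne k, fun k => ?_, fun k l hkl => ?_⟩
  · rw [hnode _ _ (hB k).2, hnode _ _ (hB' k).2]
  · simp only [hnode _ _ (hB _).2] at hkl
    exact Fin.ext (hi (hinj hkl))

/-- An infinite cardinal is the sum of `cf(κ)` many smaller cardinals. -/
theorem exists_sum_eq_of_cof (hκ : ℵ₀ ≤ κ) :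
    ∃ c : κ.ord.cof.ord.ToType → Cardinal.{u}, (∀ i, c i < κ) ∧ Cardinal.sum c = κ := by
  have := noMaxOrder hκ
  obtain ⟨s, hs, hs'⟩ := Order.exists_cof_eq κ.ord.ToType
  rw [Ordinal.cof_toType, ← mk_ord_toType κ.ord.cof] at hs'
  obtain ⟨e⟩ := Cardinal.eq.1 hs'.symm
  have hlt : ∀ i, #(Set.Iio (e i : κ.ord.ToType)) < κ := fun i => by
    simpa using mk_Iio_lt (e i : κ.ord.ToType) (by simp)
  -- The summands are the sizes of the initial segments below the points of a cofinal set of order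
  -- `cf(κ)`; these segments cover `κ`.
  refine ⟨fun i => #(Set.Iio (e i : κ.ord.ToType)), hlt, le_antisymm ?_ ?_⟩
  · refine (sum_le_mk_mul_iSup _).trans ?_
    rw [mk_ord_toType]
    exact (mul_le_mul' (Ordinal.cof_ord_le κ) (ciSup_le' fun i => (hlt i).le)).trans
      (mul_eq_self hκ).le
  · have hU : ⋃ i, Set.Iio (e i : κ.ord.ToType) = Set.univ := by
      rw [← isCofinal_iff_iUnion_Iio_eq_univ.1 hs, ← Set.iUnion_coe_set s fun x => Set.Iio x.1]
      exact e.surjective.iUnion_comp fun x : s => Set.Iio (x : κ.ord.ToType)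
    calc κ = #(⋃ i, Set.Iio (e i : κ.ord.ToType)) := by rw [hU, mk_univ, mk_ord_toType]
      _ ≤ _ := mk_iUnion_le_sum_mk

theorem le_mk_branches_through (hκ : ℵ₀ ≤ κ) (s : Node κ) :
    κ ≤ #{B : Branch κ | s ∈ B.nodes} := by
  classical
  have : Infinite κ.ord.ToType := infinite_iff.2 (by simpa using hκ)
  have hlt : #(Set.Iio s.lev) < #κ.ord.ToType := mk_Iio_lt s.lev (by simp)
  have hc : #((Set.Iio s.lev)ᶜ : Set κ.ord.ToType) = κ := by
    rw [mk_compl_of_infinite _ hlt, mk_ord_toType]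
  -- Continue `s` by zeros with a single one at `ξ`; the `κ` many positions `ξ` not below `s.lev`
  -- give different branches.
  let b : κ.ord.ToType → Branch κ := fun ξ ζ =>
    if h : ζ < s.lev then s.val ⟨ζ, h⟩ else decide (ζ = ξ)
  have hb : ∀ ξ, s ∈ (b ξ).nodes := by
    intro ξ
    refine ⟨s.lev, ?_⟩
    obtain ⟨l, f⟩ := s
    unfold Branch.node
    congr 1
    funext ζ
    exact dif_pos ζ.2
  refine hc.symm.le.trans ?_
  refine mk_le_of_injective (f := fun ξ => ⟨b ξ, hb ξ⟩) fun ξ ξ' h => ?_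
  have h1 : b ξ ξ = b ξ' ξ := congrFun (congrArg Subtype.val h) ξ
  have hξ : ¬ (ξ : κ.ord.ToType) < s.lev := ξ.2
  simp only [b, dif_neg hξ, decide_true] at h1
  exact Subtype.ext (of_decide_eq_true h1.symm)

/-- Level `μ` has `2 ^ μ` nodes, enough for `cf(κ)` distinct ones, and at least `κ` branches pass
through each. -/
theorem exists_isSpreadFamily (hκ : ℵ₀ ≤ κ) {μ : Cardinal.{u}} (hμκ : μ < κ)
    (hμ : κ.ord.cof ≤ 2 ^ μ) : ∃ A : Set (Branch κ), IsSpreadFamily κ μ A := by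
  obtain ⟨c, hc, hsum⟩ := exists_sum_eq_of_cof hκ
  let l : κ.ord.ToType := Ordinal.ToType.mk ⟨μ.ord, ord_lt_ord.2 hμκ⟩
  have hl : ((l.toOrd : Set.Iio κ.ord) : Ordinal.{u}) = μ.ord := by simp [l]
  have hIio : #(Set.Iio l) = μ := by
    have h := Ordinal.card_typein (r := LT.lt) l
    have h' : Ordinal.typein LT.lt l = μ.ord := hl
    rw [h', card_ord] at h
    exact h.symm
  have hle : #κ.ord.cof.ord.ToType ≤ #(Set.Iio l → Bool) := by
    simpa [hIio] using hμ
  obtain ⟨j⟩ := Cardinal.le_def _ _ |>.1 hle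
  let t : κ.ord.cof.ord.ToType → Node κ := fun i => ⟨l, j i⟩
  have hA : ∀ i, ∃ A' ⊆ {B : Branch κ | t i ∈ B.nodes}, #A' = c i := fun i =>
    le_mk_iff_exists_subset.1 ((hc i).le.trans (le_mk_branches_through hκ (t i)))
  choose A' hA' hcard using hA
  refine ⟨_, c, t, A', hc, hsum, fun i i' h => j.injective ?_, fun i => hl, hcard,
    fun i B hB => hA' i hB, rfl⟩
  simpa [t] using h

/-! ### The counterexamples -/

theorem not_isEquivalentToEllOneBasis_of_hasManyPairs (hκ : ℵ₀ ≤ κ) {ν : Cardinal.{u}}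
    {A : Set (Branch κ)} (h : ∀ T ⊆ A, #T = ν → HasManyPairs T)
    {S : Set (StrongDual ℝ (X κ))} (hS : S ⊆ branchFunctionals hκ A) :
    ¬ IsEquivalentToEllOneBasis ν S := by
  obtain ⟨T, hT, rfl⟩ := Set.subset_image_iff.1 hS
  intro hb
  have hcard : #T = ν := (mk_branchFunctionals hκ T).symm.trans hb.1
  exact (h T hT hcard).not_isEquivalentToEllOneBasis hκ ν hb

theorem isHaydonCounterexample_branchFunctionals (hκ : ℵ₀ ≤ κ) {ν : Cardinal.{u}}
    {A : Set (Branch κ)} (hA : #A = ν) (h : ∀ T ⊆ A, #T = ν → HasManyPairs T) :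
    IsHaydonCounterexample ν (branchFunctionals hκ A) where
  isBounded := isBounded_branchFunctionals hκ A
  card_eq := (mk_branchFunctionals hκ A).trans hA
  no_weaklyCauchy := not_containsWeaklyCauchySeq hκ A
  no_ellOneBasis _ hT := not_isEquivalentToEllOneBasis_of_hasManyPairs hκ h hT

theorem exists_lt_le_two_power {κ : Cardinal.{u}} (h0 : κ ≠ 0) (h : ¬ κ.IsStrongLimit) :
    ∃ μ : Cardinal.{u}, μ < κ ∧ κ ≤ 2 ^ μ := by
  by_contra! hc
  exact h ⟨h0, fun μ hμ => hc μ hμ⟩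

theorem isHaydonCounterexample_of_lt {μ : Cardinal.{u}} (hμ : ℵ₀ ≤ μ)
    (hμκ : μ < κ) (A : Set (Branch μ)) (hA : #A = κ) :
    IsHaydonCounterexample κ (branchFunctionals hμ A) :=
  isHaydonCounterexample_branchFunctionals hμ hA fun _ _ hT =>
    hasManyPairs_of_lt_mk hμ (hT ▸ hμκ)

theorem not_isStrongLimit_case (κ : Cardinal.{u}) (hκ : ℵ₀ < κ)
    (h : ¬ κ.IsStrongLimit) :
    (∃ μ : Cardinal.{u}, ℵ₀ ≤ μ ∧ μ < κ ∧ κ ≤ 2 ^ μ) ∧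
      ∀ (μ : Cardinal.{u}) (hμ : ℵ₀ ≤ μ), μ < κ → κ ≤ 2 ^ μ →
        Bornology.IsBounded (branchFunctionals hμ Set.univ) ∧
        #(branchFunctionals hμ Set.univ) = 2 ^ μ ∧
        (¬ ContainsWeaklyCauchySeq (branchFunctionals hμ Set.univ)) ∧
        (∀ T ⊆ branchFunctionals hμ Set.univ,
          ¬ IsEquivalentToEllOneBasis κ T) ∧
        (∃ A : Set (Branch μ), #A = κ) ∧
        (∀ A : Set (Branch μ), #A = κ →
          IsHaydonCounterexample κ (branchFunctionals hμ A)) := by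
  refine ⟨?_, fun μ hμ hμκ hκμ => ⟨isBounded_branchFunctionals hμ _, ?_,
    not_containsWeaklyCauchySeq hμ _, fun T hT => ?_, ?_,
    isHaydonCounterexample_of_lt hμ hμκ⟩⟩
  · obtain ⟨μ, hμκ, hκμ⟩ := exists_lt_le_two_power (aleph0_pos.trans hκ).ne' h
    refine ⟨μ, ?_, hμκ, hκμ⟩
    -- A finite `μ` would make `2 ^ μ` finite, hence smaller than `κ`.
    by_contra! hfin
    exact (hκ.trans_le hκμ).not_gt (power_lt_aleph0 (natCast_lt_aleph0 (n := 2)) hfin)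
  · rw [mk_branchFunctionals, mk_univ, mk_branch]
  · exact not_isEquivalentToEllOneBasis_of_hasManyPairs hμ
      (fun T _ hT => hasManyPairs_of_lt_mk hμ (hT ▸ hμκ)) hT
  · exact le_mk_iff_exists_set.1 (hκμ.trans (mk_branch μ).ge)

theorem isStrongLimit_case (κ : Cardinal.{u}) (hκ : ℵ₀ < κ)
    (h : κ.IsStrongLimit) (hcof : ¬ κ.ord.cof.IsStrongLimit) :
    (∃ μ : Cardinal.{u}, μ < κ.ord.cof ∧ κ.ord.cof ≤ 2 ^ μ) ∧
      ∀ μ : Cardinal.{u}, μ < κ.ord.cof → κ.ord.cof ≤ 2 ^ μ →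
        (∃ A : Set (Branch κ), IsSpreadFamily κ μ A) ∧
        ∀ A : Set (Branch κ), IsSpreadFamily κ μ A →
          IsHaydonCounterexample κ (branchFunctionals hκ.le A) := by
  -- A regular `κ` is excluded: its cofinality would be the strong limit `κ` itself.
  have hlt : κ.ord.cof < κ := (Ordinal.cof_ord_le κ).lt_of_ne fun heq => hcof (by rwa [heq])
  refine ⟨exists_lt_le_two_power ?_ hcof, fun μ hμ hμ' =>
    ⟨exists_isSpreadFamily hκ.le (hμ.trans hlt) hμ', fun A hA =>
      isHaydonCounterexample_branchFunctionals hκ.le hA.mk_eq fun T hTA hT =>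
        hA.hasManyPairs hκ hlt hTA hT⟩⟩
  rw [Ne, Ordinal.cof_eq_zero]
  simpa using (aleph0_pos.trans hκ).ne'

end NonsepTree

theorem mainTheorem4 (κ : Cardinal.{u}) (hκ : ℵ₀ < κ) :
    -- the answer to Haydon's problem for `κ` is negative
    ((¬ κ.IsStrongLimit ∨ ¬ κ.ord.cof.IsStrongLimit) →
      ∃ (E : Type u) (_ : NormedAddCommGroup E) (_ : NormedSpace ℝ E) (_ : CompleteSpace E)
        (S : Set E), NonsepTree.IsHaydonCounterexample κ S) ∧
    -- first case: `κ` is not a strong limit; the example is in the dual of `X_μ`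
    (¬ κ.IsStrongLimit →
      (∃ μ : Cardinal.{u}, ℵ₀ ≤ μ ∧ μ < κ ∧ κ ≤ 2 ^ μ) ∧
      ∀ (μ : Cardinal.{u}) (hμ : ℵ₀ ≤ μ), μ < κ → κ ≤ 2 ^ μ →
        Bornology.IsBounded (NonsepTree.branchFunctionals hμ Set.univ) ∧
        #(NonsepTree.branchFunctionals hμ Set.univ) = 2 ^ μ ∧
        (¬ NonsepTree.ContainsWeaklyCauchySeq (NonsepTree.branchFunctionals hμ Set.univ)) ∧
        (∀ T ⊆ NonsepTree.branchFunctionals hμ Set.univ,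
          ¬ NonsepTree.IsEquivalentToEllOneBasis κ T) ∧
        (∃ A : Set (NonsepTree.Branch μ), #A = κ) ∧
        (∀ A : Set (NonsepTree.Branch μ), #A = κ →
          NonsepTree.IsHaydonCounterexample κ (NonsepTree.branchFunctionals hμ A))) ∧
    -- second case: `κ` is a strong limit, but its cofinality is not; the example is in the dual
    -- of `X_κ`
    (κ.IsStrongLimit → ¬ κ.ord.cof.IsStrongLimit →
      (∃ μ : Cardinal.{u}, μ < κ.ord.cof ∧ κ.ord.cof ≤ 2 ^ μ) ∧
      ∀ μ : Cardinal.{u}, μ < κ.ord.cof → κ.ord.cof ≤ 2 ^ μ →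
        (∃ A : Set (NonsepTree.Branch κ), NonsepTree.IsSpreadFamily κ μ A) ∧
        ∀ A : Set (NonsepTree.Branch κ), NonsepTree.IsSpreadFamily κ μ A →
          NonsepTree.IsHaydonCounterexample κ (NonsepTree.branchFunctionals hκ.le A)) := by
  have h1 := NonsepTree.not_isStrongLimit_case κ hκ
  have h2 := NonsepTree.isStrongLimit_case κ hκ
  refine ⟨fun h => ?_, h1, h2⟩
  by_cases hs : κ.IsStrongLimit
  · obtain ⟨⟨μ, hμ, hμ'⟩, hall⟩ := h2 hs (h.resolve_left (not_not.2 hs))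
    obtain ⟨⟨A, hA⟩, hA'⟩ := hall μ hμ hμ'
    exact ⟨_, inferInstance, inferInstance, inferInstance, _, hA' A hA⟩
  · obtain ⟨⟨μ, hμ, hμκ, hκμ⟩, hall⟩ := h1 hs
    obtain ⟨-, -, -, -, ⟨A, hA⟩, hA'⟩ := hall μ hμ hμκ hκμ
    exact ⟨_, inferInstance, inferInstance, inferInstance, _, hA' A hA⟩
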